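/- Let $\mathcal{C}$ be an $\infty$-category (that is, a quasicategory) and let $\alpha$ be an equivalence in $\mathcal{C}$, i.e. an edge of $\mathcal{C}$ whose class in the homotopy category of $\mathcal{C}$ is an isomorphism. Let $n\geq 2$ and let $\bar\alpha\colon \Lambda^n_0\to\mathcal{C}$ be an outer horn whose restriction along the edge $\langle 01\rangle\colon\Delta^1\to\Lambda^n_0$ is $\alpha$. Then the fiber $$\mathcal{C}^{\Delta^n}\times_{\mathcal{C}^{\Lambda^n_0}}\{\bar\alpha\},$$ that is, the fiber over the vertex $\bar\alpha$ of the restriction map $\mathcal{C}^{\Delta^n}\to\mathcal{C}^{\Lambda^n_0}$ of simplicial mapping objects, which parametrizes the extensions of $\bar\alpha$ to $\Delta^n$, is a contractible $\infty$-groupoid: it is a Kan complex $X$, and every map $\partial\Delta^m\to X$ with $m\geq 0$ extends to $\Delta^m$. -/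

import Mathlib

open CategoryTheory Simplicial MonoidalCategory

universe u

namespace InftyCat

/-- An edge `α : x ⟶ y` of an `∞`-category (quasicategory) `C` is an *equivalence* if its class in
the homotopy category of `C` is an isomorphism. -/
def IsEquivalence {C : SSet.{u}} {x y : C _⦋0⦌} (α : SSet.Edge x y) : Prop :=
  IsIso (SSet.Truncated.HomotopyCategory.homMk α.toTruncated)

/-- For `n ≥ 2`, the map `⟨01⟩ : Δ[1] ⟶ Λ[n, 0]` given by the edge `0 → 1` of the horn. -/
def hornEdge01 (n : ℕ) (hn : 2 ≤ n) : (Δ[1] : SSet.{u}) ⟶ (Λ[n, 0] : SSet.{u}) :=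
  SSet.yonedaEquiv.symm (SSet.horn.edge n 0 0 1 (Fin.zero_le _)
    (le_trans (by simpa using Finset.card_insert_le (0 : Fin (n + 1)) {1}) hn))

/-- For a map of simplicial sets `i : A ⟶ B` and a diagram `f : A ⟶ C`, the simplicial set
`C ^ B ×_{C ^ A} {f}` of extensions of `f` along `i`: the pullback of the restriction map
`C ^ B ⟶ C ^ A` along the vertex of `C ^ A` corresponding to `f`. -/
noncomputable def extensionFiber {A B C : SSet.{u}} (i : A ⟶ B) (f : A ⟶ C) : SSet.{u} :=
  Limits.pullback ((MonoidalClosed.pre i).app C) (MonoidalClosed.curry' f)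

/-- A *contractible `∞`-groupoid*: a Kan complex `X` such that the projection from `X` to the
point is a trivial Kan fibration, that is, every map `∂Δ[m] ⟶ X`, `m ≥ 0`, extends to `Δ[m]`. -/
structure IsContractibleInftyGroupoid (X : SSet.{u}) : Prop where
  kanComplex : SSet.KanComplex X
  exists_extension : ∀ (m : ℕ) (β : (∂Δ[m] : SSet.{u}) ⟶ X),
    ∃ γ : (Δ[m] : SSet.{u}) ⟶ X, ∂Δ[m].ι ≫ γ = β

end InftyCat

/-!
The class of `α` being invertible, `C` has a `3`-simplex `x → y → x → y` whose face `0, 2, 3` is a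
degeneration of `α` and whose edge `1, 3` is degenerate. Substituting it for the edge `0 → 1` of
`Δ[n]` enlarges `Δ[n]` to `Δ[n + 2]`, of which `Δ[n]` is a retract through the faces avoiding `1`
and `2`. What blocks the extension of an outer horn is that its missing face contains the initial
vertex; in the enlarged simplex, all the required extensions are relative to the vertices `3`, `2`
and `1`, hence inner anodyne. This solves lifting problems of `Λ[n, 0] ⟶ Δ[n]` against inner
fibrations between quasicategories.

A map `∂Δ[m] ⟶ C ^ Δ[n] ×_{C ^ Λ[n, 0]} {a}` extends to `Δ[m]` as soon as `Λ[n, 0] ⟶ Δ[n]` lifts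
against the inner fibration `C ^ Δ[m] ⟶ C ^ ∂Δ[m]`, for a lifting problem in which the horn is the
constant family at `a`. The image of the `3`-simplex above under `C ⟶ C ^ Δ[m]` shows that the
first edge of this horn is invertible too.
-/

namespace InftyCat

open SSet Limits CartesianMonoidalCategory

section Gluing

variable {X E S : SSet.{u}} {A B D : X.Subcomplex}

lemma hom_ext_of_le_sup {f g : (D : SSet.{u}) ⟶ E} (h : D ≤ A ⊔ B)
    (hA : Subcomplex.homOfLE (inf_le_left : D ⊓ A ≤ D) ≫ f = Subcomplex.homOfLE inf_le_left ≫ g)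
    (hB : Subcomplex.homOfLE (inf_le_left : D ⊓ B ≤ D) ≫ f = Subcomplex.homOfLE inf_le_left ≫ g) :
    f = g := by
  ext d ⟨x, hx⟩
  obtain hxA | hxB := h d hx
  · exact congr($(hA).app d ⟨x, hx, hxA⟩)
  · exact congr($(hB).app d ⟨x, hx, hxB⟩)

lemma exists_lift_of_sup_le (hAB : A ⊔ B ≤ D)
    (hi : innerAnodyneExtensions (Subcomplex.homOfLE hAB)) (p : E ⟶ S) [InnerFibration p]
    (f : (A : SSet.{u}) ⟶ E) (g : (B : SSet.{u}) ⟶ E)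
    (hfg : Subcomplex.homOfLE (inf_le_left : A ⊓ B ≤ A) ≫ f =
      Subcomplex.homOfLE inf_le_right ≫ g)
    (q : (D : SSet.{u}) ⟶ S) (hf : f ≫ p = Subcomplex.homOfLE (le_sup_left.trans hAB) ≫ q)
    (hg : g ≫ p = Subcomplex.homOfLE (le_sup_right.trans hAB) ≫ q) :
    ∃ k : (D : SSet.{u}) ⟶ E, Subcomplex.homOfLE (le_sup_left.trans hAB) ≫ k = f ∧
      Subcomplex.homOfLE (le_sup_right.trans hAB) ≫ k = g ∧ k ≫ p = q := by
  have bicartSq : Subcomplex.BicartSq (A ⊓ B) A B (A ⊔ B) := { sup_eq := rfl, inf_eq := rfl }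
  obtain ⟨k, hkf, hkg⟩ := bicartSq.isPushout.exists_desc f g hfg
  have hlift := hi p (mem_innerFibrations p)
  have sq : CommSq k (Subcomplex.homOfLE hAB) p q :=
    ⟨bicartSq.isPushout.hom_ext (by rw [← Category.assoc, hkf, hf]; rfl)
      (by rw [← Category.assoc, hkg, hg]; rfl)⟩
  refine ⟨sq.lift, ?_, ?_, sq.fac_right⟩
  · exact congr(Subcomplex.homOfLE le_sup_left ≫ $(sq.fac_left)).trans hkf
  · exact congr(Subcomplex.homOfLE le_sup_right ≫ $(sq.fac_left)).trans hkg

lemma exists_extension_of_sup_le [Quasicategory E] (hAB : A ⊔ B ≤ D)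
    (hi : innerAnodyneExtensions (Subcomplex.homOfLE hAB))
    (f : (A : SSet.{u}) ⟶ E) (g : (B : SSet.{u}) ⟶ E)
    (hfg : Subcomplex.homOfLE (inf_le_left : A ⊓ B ≤ A) ≫ f =
      Subcomplex.homOfLE inf_le_right ≫ g) :
    ∃ k : (D : SSet.{u}) ⟶ E, Subcomplex.homOfLE (le_sup_left.trans hAB) ≫ k = f ∧
      Subcomplex.homOfLE (le_sup_right.trans hAB) ≫ k = g := by
  obtain ⟨k, hkf, hkg, -⟩ := exists_lift_of_sup_le hAB hi (terminal.from E) f g hfg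
    (terminal.from _) (Subsingleton.elim _ _) (Subsingleton.elim _ _)
  exact ⟨k, hkf, hkg⟩

lemma innerAnodyneExtensions_homOfLE_sup_range (A : X.Subcomplex) {n : ℕ} {i : Fin (n + 1)}
    (h₀ : 0 < i) (hₙ : i < Fin.last n) (φ : Δ[n] ⟶ X) [Mono φ] (hφ : A.preimage φ = Λ[n, i]) :
    innerAnodyneExtensions
      (Subcomplex.homOfLE (le_sup_left : A ≤ A ⊔ Subcomplex.range φ)) := by
  have bicartSq : Subcomplex.BicartSq (A ⊓ Subcomplex.range φ) A (Subcomplex.range φ)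
    (A ⊔ Subcomplex.range φ) := { sup_eq := rfl, inf_eq := rfl }
  refine MorphismProperty.of_isPushout bicartSq.isPushout ?_
  have himage : Λ[n, i].image φ = A ⊓ Subcomplex.range φ := by
    rw [← hφ]
    ext d x
    exact ⟨by rintro ⟨y, hy, rfl⟩; exact ⟨hy, y, rfl⟩,
      by rintro ⟨hx, y, rfl⟩; exact ⟨y, hx, rfl⟩⟩
  have : Mono (Λ[n, i].toImage φ) := mono_of_mono_fac (Subcomplex.toImage_ι _ φ)
  have : IsIso (Λ[n, i].toImage φ) := isIso_of_mono_of_epi _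
  refine (innerAnodyneExtensions.arrow_mk_iso_iff ?_).1 (innerAnodyneExtensions.horn_ι h₀ hₙ)
  exact Arrow.isoMk (asIso (Λ[n, i].toImage φ) ≪≫ Subcomplex.eqToIso himage)
    (asIso (Subcomplex.toRange φ)) (by ext; rfl)

end Gluing

section Faces

open SSet.stdSimplex (face face_le_face_iff face_eq_ofSimplex mem_face_iff monotone_apply)

variable {N M : ℕ}

/-- A simplex of `Δ[N]` is a degeneracy of the face spanned by its vertices. -/
lemma mem_subcomplex_iff_face_le (A : (Δ[N] : SSet.{u}).Subcomplex) {d : ℕ}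
    (x : (Δ[N] : SSet.{u}) _⦋d⦌) :
    x ∈ A.obj _ ↔ face (Finset.univ.image x) ≤ A := by
  refine ⟨fun hx ↦ ?_, fun h ↦ h _ (by simp [mem_face_iff])⟩
  obtain ⟨m, hm⟩ := Nat.exists_eq_succ_of_ne_zero
    (Finset.univ_nonempty.image x).card_pos.ne'
  let e := (Finset.univ.image x).orderIsoOfFin hm
  rw [face_eq_ofSimplex _ m e, Subcomplex.ofSimplex_le_iff]
  choose s hs using fun i ↦ Finset.mem_image.1 (e i).2
  have hs_mono : Monotone s := fun i j hij ↦ by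
    by_contra! hlt
    have hxs : x (s j) ≤ x (s i) := monotone_apply x hlt.le
    rw [(hs i).2, (hs j).2] at hxs
    obtain rfl := hij.antisymm (e.le_iff_le.1 hxs)
    exact hlt.false
  have hx' := A.map (Quiver.Hom.op (SimplexCategory.Hom.mk ⟨s, hs_mono⟩ : ⦋m⦌ ⟶ ⦋d⦌)) hx
  rw [Set.mem_preimage] at hx'
  convert hx' using 1
  ext i : 1
  exact (hs i).2.symm

lemma exists_face_le_iff_mem {S : Finset (Fin (N + 1))} (hS : S.Nonempty) :
    ∃ (d : ℕ) (x : (Δ[N] : SSet.{u}) _⦋d⦌), Finset.univ.image x = S ∧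
      ∀ A : (Δ[N] : SSet.{u}).Subcomplex, face S ≤ A ↔ x ∈ A.obj _ := by
  obtain ⟨m, hm⟩ := Nat.exists_eq_succ_of_ne_zero hS.card_pos.ne'
  let e := S.orderIsoOfFin hm
  let x : (Δ[N] : SSet.{u}) _⦋m⦌ :=
    SSet.stdSimplex.objMk ((OrderHom.Subtype.val _).comp e.toOrderEmbedding.toOrderHom)
  have hx : Finset.univ.image x = S := by
    ext v
    simp only [Finset.mem_image, Finset.mem_univ, true_and]
    exact ⟨by rintro ⟨i, rfl⟩; exact (e i).2, fun hv ↦ ⟨e.symm ⟨v, hv⟩, by simp [x]⟩⟩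
  exact ⟨m, x, hx, fun A ↦ by rw [mem_subcomplex_iff_face_le, hx]⟩

lemma subcomplex_le_iff_face (A B : (Δ[N] : SSet.{u}).Subcomplex) :
    A ≤ B ↔ ∀ S, face S ≤ A → face S ≤ B := by
  refine ⟨fun h S hS ↦ hS.trans h, fun h ↦ ?_⟩
  rintro ⟨⟨d⟩⟩ x hx
  exact (mem_subcomplex_iff_face_le B x).2 (h _ ((mem_subcomplex_iff_face_le A x).1 hx))

lemma subcomplex_eq_iff_face (A B : (Δ[N] : SSet.{u}).Subcomplex) :
    A = B ↔ ∀ S, face S ≤ A ↔ face S ≤ B :=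
  ⟨by rintro rfl S; rfl, fun h ↦ le_antisymm ((subcomplex_le_iff_face A B).2 fun S ↦ (h S).1)
    ((subcomplex_le_iff_face B A).2 fun S ↦ (h S).2)⟩

lemma face_le_sup_iff (S : Finset (Fin (N + 1))) (A B : (Δ[N] : SSet.{u}).Subcomplex) :
    face S ≤ A ⊔ B ↔ face S ≤ A ∨ face S ≤ B := by
  obtain rfl | hS := S.eq_empty_or_nonempty
  · simp
  · obtain ⟨d, x, -, hx⟩ := exists_face_le_iff_mem.{u} hS
    simp only [hx]
    rfl

lemma face_le_iSup_iff {ι : Type*} [Nonempty ι] (S : Finset (Fin (N + 1)))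
    (A : ι → (Δ[N] : SSet.{u}).Subcomplex) :
    face S ≤ ⨆ i, A i ↔ ∃ i, face S ≤ A i := by
  obtain rfl | hS := S.eq_empty_or_nonempty
  · simp
  · obtain ⟨d, x, -, hx⟩ := exists_face_le_iff_mem.{u} hS
    simp only [hx, Subfunctor.iSup_obj, Set.mem_iUnion]

lemma face_le_preimage_map_iff (f : ⦋M⦌ ⟶ ⦋N⦌) (S : Finset (Fin (M + 1)))
    (A : (Δ[N] : SSet.{u}).Subcomplex) :
    face S ≤ A.preimage (SSet.stdSimplex.map f) ↔ face (S.image f) ≤ A := by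
  obtain rfl | hS := S.eq_empty_or_nonempty
  · simp
  · obtain ⟨d, x, rfl, hx⟩ := exists_face_le_iff_mem.{u} hS
    rw [hx, Finset.image_image]
    exact mem_subcomplex_iff_face_le A ((SSet.stdSimplex.map f).app _ x)

lemma preimage_map_eq_horn {m : ℕ} (f : ⦋m + 1⦌ ⟶ ⦋N⦌) [Mono f] (i : Fin (m + 2))
    (A : (Δ[N] : SSet.{u}).Subcomplex)
    (hA : ∀ T ⊆ Finset.univ.image f, face T ≤ A ↔ ¬ (Finset.univ.image f).erase (f i) ⊆ T) :
    A.preimage (SSet.stdSimplex.map f) = Λ[m + 1, i] := by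
  have hf : Function.Injective f := SimplexCategory.mono_iff_injective.1 inferInstance
  have herase : (Finset.univ.image f).erase (f i) = ({i}ᶜ : Finset _).image f := by
    rw [← Finset.image_erase hf, Finset.compl_singleton]
  refine (subcomplex_eq_iff_face _ _).2 fun U ↦ ?_
  rw [face_le_preimage_map_iff, hA _ (Finset.image_subset_image U.subset_univ), herase,
    Finset.image_subset_image_iff hf, subcomplex_le_horn_iff, face_le_face_iff]

lemma innerAnodyneExtensions_homOfLE_sup_face (A : (Δ[N] : SSet.{u}).Subcomplex)
    {S : Finset (Fin (N + 1))} {b : Fin (N + 1)} (hbS : b ∈ S) (hlt : ∃ s ∈ S, s < b)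
    (hgt : ∃ s ∈ S, b < s) (hA : ∀ T ⊆ S, face T ≤ A ↔ ¬ S.erase b ⊆ T) :
    innerAnodyneExtensions (Subcomplex.homOfLE (le_sup_left : A ≤ A ⊔ face S)) := by
  obtain ⟨s, hsS, hsb⟩ := hlt
  obtain ⟨t, htS, hbt⟩ := hgt
  obtain ⟨m, hm⟩ := Nat.exists_eq_add_of_le' (Finset.one_lt_card.2 ⟨s, hsS, b, hbS, hsb.ne⟩)
  let e : Fin (m + 2) ≃o S := S.orderIsoOfFin hm
  let f : ⦋m + 1⦌ ⟶ ⦋N⦌ := SimplexCategory.Hom.mk (S.orderEmbOfFin hm).toOrderHom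
  have : Mono f := SimplexCategory.mono_iff_injective.2 (S.orderEmbOfFin hm).injective
  have hfS : Finset.univ.image f = S := Finset.image_orderEmbOfFin_univ S hm
  let φ : (Δ[m + 1] : SSet.{u}) ⟶ Δ[N] := SSet.stdSimplex.map f
  have : Mono φ := inferInstanceAs (Mono (uliftYoneda.{u}.map f))
  have hrange : Subcomplex.range φ = face S := by
    rw [Subcomplex.range_eq_ofSimplex, face_eq_ofSimplex S _ e]
    rfl
  have hfe : f (e.symm ⟨b, hbS⟩) = b := congrArg Subtype.val (e.apply_symm_apply ⟨b, hbS⟩)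
  have hpreimage := preimage_map_eq_horn f (e.symm ⟨b, hbS⟩) A (by rwa [hfS, hfe])
  rw [← hrange]
  refine innerAnodyneExtensions_homOfLE_sup_range A ?_ ?_ φ hpreimage
  · exact (Fin.zero_le _).trans_lt (e.symm.lt_iff_lt.2 (show (⟨s, hsS⟩ : S) < ⟨b, hbS⟩ from hsb))
  · exact (e.symm.lt_iff_lt.2 (show (⟨b, hbS⟩ : S) < ⟨t, htS⟩ from hbt)).trans_le (Fin.le_last _)

lemma exists_minimal_missing_face {A B : (Δ[N] : SSet.{u}).Subcomplex} (b : Fin (N + 1))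
    (hb : ∀ S, face S ≤ B → ¬ face S ≤ A → face (insert b S) ≤ B) (h : ¬ B ≤ A) :
    ∃ S, face S ≤ B ∧ ¬ face S ≤ A ∧ b ∈ S ∧
      ∀ T ⊆ S, ¬ face T ≤ A → S.erase b ⊆ T := by
  obtain ⟨S₀, hS₀B, hS₀A⟩ : ∃ S, face S ≤ B ∧ ¬ face S ≤ A := by
    rw [subcomplex_le_iff_face] at h
    push Not at h
    exact h
  obtain ⟨S, ⟨hSB, hSA, hbS⟩, hmin⟩ := exists_minimal_of_wellFoundedLT
    (fun S ↦ face.{u} S ≤ B ∧ ¬ face.{u} S ≤ A ∧ b ∈ S) ⟨insert b S₀, hb S₀ hS₀B hS₀A,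
      fun h ↦ hS₀A (((face_le_face_iff _ _).2 (Finset.subset_insert b S₀)).trans h),
      Finset.mem_insert_self b S₀⟩
  refine ⟨S, hSB, hSA, hbS, fun T hTS hTA ↦ ?_⟩
  have hST : S ≤ insert b T := hmin ⟨hb T (((face_le_face_iff _ _).2 hTS).trans hSB) hTA,
    fun h ↦ hTA (((face_le_face_iff _ _).2 (Finset.subset_insert b T)).trans h),
    Finset.mem_insert_self b T⟩ (Finset.insert_subset hbS hTS)
  exact Finset.subset_insert_iff.1 hST

/-- If every missing simplex stays missing under removing or adding `b`, the missing simplices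
can be attached in pairs `(S, S.erase b)`, each along an inner horn. -/
lemma innerAnodyneExtensions_homOfLE_of_missing_faces {A B : (Δ[N] : SSet.{u}).Subcomplex}
    (h : A ≤ B) (b : Fin (N + 1)) (hb : ∀ S, face S ≤ B → ¬ face S ≤ A →
      face (insert b S) ≤ B ∧ ¬ face (S.erase b) ≤ A ∧ (∃ s ∈ S, s < b) ∧ ∃ s ∈ S, b < s) :
    innerAnodyneExtensions (Subcomplex.homOfLE h) := by
  induction hk : {S | face S ≤ B ∧ ¬ face S ≤ A}.ncard
    using Nat.strong_induction_on generalizing A with | _ k ih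
  by_cases hBA : B ≤ A
  · obtain rfl := h.antisymm hBA
    exact MorphismProperty.id_mem innerAnodyneExtensions (A : SSet.{u})
  obtain ⟨S, hSB, hSA, hbS, hmin⟩ :=
    exists_minimal_missing_face b (fun S hSB hSA ↦ (hb S hSB hSA).1) hBA
  obtain ⟨-, hSb, hlt, hgt⟩ := hb S hSB hSA
  have hattach := innerAnodyneExtensions_homOfLE_sup_face A hbS hlt hgt
    fun T hTS ↦ ⟨fun hT hST ↦ hSb (((face_le_face_iff _ _).2 hST).trans hT), fun hST ↦ by
      by_contra hTA
      exact hST (hmin T hTS hTA)⟩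
  refine MorphismProperty.comp_mem _ _ (Subcomplex.homOfLE (sup_le h hSB)) hattach
    (ih _ ?_ (sup_le h hSB) (fun T hTB hTA ↦ ?_) rfl)
  · rw [← hk]
    refine Set.ncard_lt_ncard (Set.ssubset_iff_of_subset ?_ |>.2
      ⟨S, ⟨hSB, hSA⟩, fun hS ↦ hS.2 le_sup_right⟩)
    exact fun T hT ↦ ⟨hT.1, fun hTA ↦ hT.2 (hTA.trans le_sup_left)⟩
  · rw [face_le_sup_iff, not_or, face_le_face_iff] at hTA ⊢
    obtain ⟨hinsert, herase, hlt_gt⟩ := hb T hTB hTA.1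
    exact ⟨hinsert, ⟨herase, fun hTS ↦
      hTA.2 ((Finset.erase_subset_iff_of_mem hbS).1 hTS)⟩, hlt_gt⟩

end Faces

section VertexMaps

open SSet.stdSimplex (face face_le_face_iff monotone_apply)

variable {N M L : ℕ}

/-- A map `κ` on vertices which carries the faces of `A` monotonically to faces of `B`, so that
composition with `κ` is a morphism `A ⟶ B`; there is no condition on the vertices outside a common
face, so `κ` need not be monotone. -/
structure MapsFaces (A : (Δ[N] : SSet.{u}).Subcomplex) (B : (Δ[M] : SSet.{u}).Subcomplex)
    (κ : Fin (N + 1) → Fin (M + 1)) : Prop where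
  monotoneOn : ∀ S, face S ≤ A → MonotoneOn κ S
  face_image_le : ∀ S, face S ≤ A → face (S.image κ) ≤ B

namespace MapsFaces

variable {A A' : (Δ[N] : SSet.{u}).Subcomplex} {B : (Δ[M] : SSet.{u}).Subcomplex}
  {D : (Δ[L] : SSet.{u}).Subcomplex} {κ κ' : Fin (N + 1) → Fin (M + 1)}
  {τ : Fin (M + 1) → Fin (L + 1)}

lemma monotone (h : MapsFaces A B κ) {d : ℕ} {x : (Δ[N] : SSet.{u}) _⦋d⦌} (hx : x ∈ A.obj _) :
    Monotone (κ ∘ x) := fun _ _ hij ↦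
  h.monotoneOn _ ((mem_subcomplex_iff_face_le A x).1 hx) (by simp) (by simp) (monotone_apply x hij)

lemma objMk_mem (h : MapsFaces A B κ) {d : ℕ} {x : (Δ[N] : SSet.{u}) _⦋d⦌} (hx : x ∈ A.obj _) :
    (SSet.stdSimplex.objMk ⟨κ ∘ x, h.monotone hx⟩ : (Δ[M] : SSet.{u}) _⦋d⦌) ∈ B.obj _ := by
  have hface := h.face_image_le _ ((mem_subcomplex_iff_face_le A x).1 hx)
  rw [Finset.image_image] at hface
  exact (mem_subcomplex_iff_face_le B _).2 hface

/-- The morphism which composes a simplex, seen as a sequence of vertices, with `κ`. -/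
def hom (h : MapsFaces A B κ) : (A : SSet.{u}) ⟶ (B : SSet.{u}) where
  app := fun ⟨⟨_⟩⟩ ↦ TypeCat.ofHom fun x ↦ ⟨SSet.stdSimplex.objMk _, h.objMk_mem x.2⟩
  naturality := by rintro ⟨⟨_⟩⟩ ⟨⟨_⟩⟩ _; rfl

lemma hom_eq_hom (h : MapsFaces A B κ) (h' : MapsFaces A B κ')
    (heq : ∀ S, face S ≤ A → ∀ i ∈ S, κ i = κ' i) : h.hom = h'.hom := by
  ext ⟨⟨d⟩⟩ ⟨x, hx⟩
  refine Subtype.ext ?_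
  ext i : 1
  exact heq _ ((mem_subcomplex_iff_face_le A x).1 hx) (x i) (by simp)

lemma comp (h : MapsFaces A B κ) (k : MapsFaces B D τ) : MapsFaces A D (τ ∘ κ) where
  monotoneOn S hS := (k.monotoneOn _ (h.face_image_le S hS)).comp (h.monotoneOn S hS)
    fun _ hi ↦ by simpa using ⟨_, hi, rfl⟩
  face_image_le S hS := by
    rw [← Finset.image_image]
    exact k.face_image_le _ (h.face_image_le S hS)

lemma hom_eq_homOfLE {κ : Fin (N + 1) → Fin (N + 1)} (h : MapsFaces A A' κ) (hA : A ≤ A')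
    (hκ : ∀ S, face S ≤ A → ∀ i ∈ S, κ i = i) : h.hom = Subcomplex.homOfLE hA := by
  ext ⟨⟨d⟩⟩ ⟨x, hx⟩
  refine Subtype.ext ?_
  ext i : 1
  exact hκ _ ((mem_subcomplex_iff_face_le A x).1 hx) (x i) (by simp)

lemma of_le (hA : A' ≤ A) (h : MapsFaces A B κ) : MapsFaces A' B κ where
  monotoneOn S hS := h.monotoneOn S (hS.trans hA)
  face_image_le S hS := h.face_image_le S (hS.trans hA)

lemma top_of_monotone (hκ : Monotone κ) : MapsFaces A ⊤ κ where
  monotoneOn _ _ := hκ.monotoneOn _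
  face_image_le _ _ := le_top

lemma ι_comp_eq_hom_comp {κ' : Fin (N + 1) → Fin (L + 1)}
    (h : MapsFaces A ⊤ κ) (h' : MapsFaces A ⊤ κ') (θ : ⦋M⦌ ⟶ ⦋N⦌) (θ' : ⦋M⦌ ⟶ ⦋L⦌)
    (hθ : ∀ S, face S ≤ A → ∀ i ∈ S, θ (κ i) = i)
    (hθ' : ∀ S, face S ≤ A → ∀ i ∈ S, θ' (κ i) = κ' i)
    {X : SSet.{u}} {φ : Δ[N] ⟶ X} {ψ : Δ[L] ⟶ X}
    (hφψ : SSet.stdSimplex.map θ ≫ φ = SSet.stdSimplex.map θ' ≫ ψ) :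
    A.ι ≫ φ = h'.hom ≫ Subcomplex.ι _ ≫ ψ := by
  have hι : A.ι = h.hom ≫ Subcomplex.ι _ ≫ SSet.stdSimplex.map θ := by
    ext ⟨⟨d⟩⟩ ⟨x, hx⟩ i
    exact congrArg Fin.val (hθ _ ((mem_subcomplex_iff_face_le A x).1 hx) (x i) (by simp)).symm
  have hι' : h'.hom ≫ Subcomplex.ι _ = h.hom ≫ Subcomplex.ι _ ≫ SSet.stdSimplex.map θ' := by
    ext ⟨⟨d⟩⟩ ⟨x, hx⟩ i
    exact congrArg Fin.val (hθ' _ ((mem_subcomplex_iff_face_le A x).1 hx) (x i) (by simp)).symm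
  calc
    _ = h.hom ≫ Subcomplex.ι _ ≫ SSet.stdSimplex.map θ ≫ φ := by rw [hι]; rfl
    _ = (h'.hom ≫ Subcomplex.ι _) ≫ ψ := by rw [hφψ, hι']; rfl

end MapsFaces

end VertexMaps

section OuterHorn

open SSet.stdSimplex (face face_le_face_iff)

variable {N m : ℕ}

open Classical in
/-- The face of `Δ[N]` spanned by the vertices whose values are not in `V`. -/
noncomputable def faceAvoiding (V : Set ℕ) : (Δ[N] : SSet.{u}).Subcomplex :=
  face (Finset.univ.filter fun i ↦ i.1 ∉ V)

lemma face_le_faceAvoiding_iff (S : Finset (Fin (N + 1))) (V : Set ℕ) :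
    face.{u} S ≤ faceAvoiding V ↔ ∀ i ∈ S, i.1 ∉ V := by
  simp [faceAvoiding, face_le_face_iff, Finset.subset_iff]

lemma faceAvoiding_anti {V V' : Set ℕ} (h : V ⊆ V') :
    faceAvoiding V' ≤ (faceAvoiding V : (Δ[N] : SSet.{u}).Subcomplex) :=
  (subcomplex_le_iff_face _ _).2 fun S hS ↦ (face_le_faceAvoiding_iff S V).2 fun i hi hV ↦
    (face_le_faceAvoiding_iff S V').1 hS i hi (h hV)

lemma face_le_horn_zero_iff (S : Finset (Fin (N + 2))) :
    face.{u} S ≤ Λ[N + 1, 0] ↔ ∃ j : Fin (N + 2), j.1 ≠ 0 ∧ j ∉ S := by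
  simp [subcomplex_le_horn_iff, face_le_face_iff, Finset.subset_iff]

/-- The simplices of `Δ[m + 3]` which omit one of the vertices `4, …, m + 3`. -/
noncomputable def tailHorn (m : ℕ) : (Δ[m + 3] : SSet.{u}).Subcomplex :=
  ⨆ j : Fin m, faceAvoiding {j.1 + 4}

/-- The union of `tailHorn m` and of the face `0, 2, 4, 5, …` of `Δ[m + 3]`, which is mapped to a
facet of the outer horn `Λ[m + 1, 0]` by `collapse m`. -/
noncomputable def enlargedHorn (m : ℕ) : (Δ[m + 3] : SSet.{u}).Subcomplex :=
  tailHorn m ⊔ faceAvoiding {1, 3}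

/-- The union of the faces `0, 2, 3, 4, …` and `1, 3, 4, …` of `Δ[m + 3]`. -/
noncomputable def zigZagFaces (m : ℕ) : (Δ[m + 3] : SSet.{u}).Subcomplex :=
  faceAvoiding {1} ⊔ faceAvoiding {0, 2}

/-- The map `0, 1, 2, 3, 4, … ↦ 0, 1, 0, 1, 2, …` on vertices, which is monotone on the faces in
`zigZagFaces m`. -/
def collapse (m : ℕ) (i : Fin (m + 4)) : Fin (m + 2) :=
  ⟨if i.1 < 2 then i.1 else i.1 - 2, by split_ifs <;> lia⟩

lemma face_le_tailHorn_iff [NeZero m] (S : Finset (Fin (m + 4))) :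
    face.{u} S ≤ tailHorn m ↔ ∃ j : Fin (m + 4), 4 ≤ j.1 ∧ j ∉ S := by
  have : Nonempty (Fin m) := ⟨0⟩
  simp only [tailHorn, face_le_iSup_iff, face_le_faceAvoiding_iff, Set.mem_singleton_iff]
  exact ⟨fun ⟨j, hj⟩ ↦ ⟨⟨j.1 + 4, by lia⟩, by simp, fun h ↦ hj _ h rfl⟩,
    fun ⟨j, hj, hjS⟩ ↦ ⟨⟨j.1 - 4, by lia⟩, fun i hi hij ↦
      hjS (by rwa [show j = i from Fin.ext (by simp only at hij; lia)])⟩⟩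

lemma face_le_enlargedHorn_iff [NeZero m] (S : Finset (Fin (m + 4))) :
    face.{u} S ≤ enlargedHorn m ↔
      (∃ j : Fin (m + 4), 4 ≤ j.1 ∧ j ∉ S) ∨ ∀ i ∈ S, i.1 ≠ 1 ∧ i.1 ≠ 3 := by
  simp [enlargedHorn, face_le_sup_iff, face_le_tailHorn_iff, face_le_faceAvoiding_iff]

lemma face_le_zigZagFaces_iff (S : Finset (Fin (m + 4))) :
    face.{u} S ≤ zigZagFaces m ↔ (∀ i ∈ S, i.1 ≠ 1) ∨ ∀ i ∈ S, i.1 ≠ 0 ∧ i.1 ≠ 2 := by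
  simp [zigZagFaces, face_le_sup_iff, face_le_faceAvoiding_iff]

lemma mapsFaces_collapse_top : MapsFaces.{u} (zigZagFaces m) ⊤ (collapse m) where
  monotoneOn S hS i hi j hj hij := by
    rw [face_le_zigZagFaces_iff] at hS
    simp only [Fin.le_def, collapse] at hij ⊢
    grind
  face_image_le _ _ := le_top

lemma mapsFaces_collapse [NeZero m] {A : (Δ[m + 3] : SSet.{u}).Subcomplex}
    (hA : A ≤ enlargedHorn m ⊓ zigZagFaces m) :
    MapsFaces A Λ[m + 1, 0] (collapse m) where
  monotoneOn S hS := mapsFaces_collapse_top.monotoneOn S (hS.trans (hA.trans inf_le_right))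
  face_image_le S hS := by
    have hS' := hS.trans hA
    rw [le_inf_iff, face_le_enlargedHorn_iff] at hS'
    simp only [face_le_horn_zero_iff, Finset.mem_image, not_exists, not_and]
    obtain ⟨⟨j, hj, hjS⟩ | hS, -⟩ := hS'
    · refine ⟨⟨j.1 - 2, by lia⟩, by simp only; lia, fun i hi hij ↦ ?_⟩
      simp only [Fin.ext_iff, collapse] at hij
      grind
    · refine ⟨⟨1, by lia⟩, by simp, fun i hi hij ↦ ?_⟩
      simp only [Fin.ext_iff, collapse] at hij
      grind

lemma sup_faceAvoiding_zero_two_le :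
    (tailHorn.{u} m ⊔ faceAvoiding {3}) ⊔ faceAvoiding {0, 2} ≤
      tailHorn m ⊔ faceAvoiding {3} ⊔ faceAvoiding {2} :=
  sup_le_sup_left (faceAvoiding_anti (by simp)) _

section InnerAnodyne

variable [NeZero m]

lemma exists_four_le : ∃ j : Fin (m + 4), 4 ≤ j.1 :=
  ⟨Fin.last _, by have := NeZero.pos m; simp only [Fin.val_last]; lia⟩

lemma enlargedHorn_inf_zigZagFaces_sup_le :
    (enlargedHorn.{u} m ⊓ zigZagFaces m) ⊔ faceAvoiding (Set.Ici 4) ≤ enlargedHorn m := by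
  refine sup_le inf_le_left ((subcomplex_le_iff_face _ _).2 fun S hS ↦ ?_)
  rw [face_le_faceAvoiding_iff] at hS
  obtain ⟨j, hj⟩ := exists_four_le (m := m)
  exact (face_le_enlargedHorn_iff S).2 (Or.inl ⟨j, hj, fun hjS ↦ hS j hjS hj⟩)

lemma innerAnodyneExtensions_enlargedHorn_inf_zigZagFaces_sup :
    innerAnodyneExtensions
      (Subcomplex.homOfLE (enlargedHorn_inf_zigZagFaces_sup_le.{u} (m := m))) := by
  refine innerAnodyneExtensions_homOfLE_of_missing_faces _ ⟨3, by lia⟩ fun S hS hS' ↦ ?_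
  simp only [le_inf_iff, face_le_sup_iff, face_le_enlargedHorn_iff, face_le_zigZagFaces_iff,
    face_le_faceAvoiding_iff, Set.mem_Ici, Fin.lt_def, Finset.mem_insert, Finset.mem_erase,
    Fin.ext_iff] at hS hS' ⊢
  grind

lemma innerAnodyneExtensions_enlargedHorn_sup_zigZagFaces :
    innerAnodyneExtensions
      (Subcomplex.homOfLE (le_top : enlargedHorn.{u} m ⊔ zigZagFaces m ≤ ⊤)) := by
  refine innerAnodyneExtensions_homOfLE_of_missing_faces _ ⟨3, by lia⟩ fun S _ hS' ↦ ?_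
  obtain ⟨j, hj⟩ := exists_four_le (m := m)
  simp only [face_le_sup_iff, face_le_enlargedHorn_iff, face_le_zigZagFaces_iff,
    Fin.lt_def, Finset.mem_erase, le_top, true_and] at hS' ⊢
  grind

lemma enlargedHorn_le : enlargedHorn.{u} m ≤ tailHorn m ⊔ faceAvoiding {3} := by
  refine (subcomplex_le_iff_face _ _).2 fun S hS ↦ ?_
  simp only [face_le_enlargedHorn_iff, face_le_sup_iff, face_le_tailHorn_iff,
    face_le_faceAvoiding_iff, Set.mem_singleton_iff] at hS ⊢
  exact hS.imp_right fun h i hi ↦ (h i hi).2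

lemma innerAnodyneExtensions_enlargedHorn_le :
    innerAnodyneExtensions (Subcomplex.homOfLE (enlargedHorn_le.{u} (m := m))) := by
  refine innerAnodyneExtensions_homOfLE_of_missing_faces _ ⟨2, by lia⟩ fun S hS hS' ↦ ?_
  obtain ⟨j, hj⟩ := exists_four_le (m := m)
  simp only [face_le_enlargedHorn_iff, face_le_sup_iff, face_le_tailHorn_iff,
    face_le_faceAvoiding_iff, Set.mem_singleton_iff, Fin.lt_def, Finset.mem_insert,
    Finset.mem_erase, Fin.ext_iff] at hS hS' ⊢
  grind

lemma innerAnodyneExtensions_sup_faceAvoiding_zero_two :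
    innerAnodyneExtensions
      (Subcomplex.homOfLE (sup_faceAvoiding_zero_two_le.{u} (m := m))) := by
  refine innerAnodyneExtensions_homOfLE_of_missing_faces _ ⟨1, by lia⟩ fun S hS hS' ↦ ?_
  obtain ⟨j, hj⟩ := exists_four_le (m := m)
  simp only [face_le_sup_iff, face_le_tailHorn_iff,
    face_le_faceAvoiding_iff, Set.mem_insert_iff, Set.mem_singleton_iff, Fin.lt_def,
    Finset.mem_insert, Finset.mem_erase, Fin.ext_iff] at hS hS' ⊢
  grind

end InnerAnodyne

section VertexMaps

/-- The map `0, 1, 2, … ↦ 0, 3, 4, …` on vertices, a section of `collapse m`. -/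
def expand (m : ℕ) (i : Fin (m + 2)) : Fin (m + 4) :=
  ⟨if i.1 = 0 then 0 else i.1 + 2, by split_ifs <;> lia⟩

/-- The map on vertices which sends `0, 1, 2, 3` to `1` and fixes the other ones. -/
def contract (m : ℕ) (i : Fin (m + 4)) : Fin (m + 4) :=
  ⟨if i.1 < 4 then 1 else i.1, by split_ifs <;> lia⟩

lemma collapse_expand (i : Fin (m + 2)) : collapse m (expand m i) = i := by
  simp only [Fin.ext_iff, collapse, expand]
  grind

lemma expand_monotone : Monotone (expand m) := fun i j hij ↦ by
  simp only [Fin.le_def, expand] at hij ⊢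
  grind

lemma contract_monotone : Monotone (contract m) := fun i j hij ↦ by
  simp only [Fin.le_def, contract] at hij ⊢
  grind

lemma mapsFaces_expand_top {B : (Δ[m + 3] : SSet.{u}).Subcomplex}
    (hB : faceAvoiding {1, 2} ≤ B) : MapsFaces ⊤ B (expand m) where
  monotoneOn _ _ := expand_monotone.monotoneOn _
  face_image_le S _ := by
    refine le_trans ?_ hB
    simp only [face_le_faceAvoiding_iff, Finset.forall_mem_image, expand, Set.mem_insert_iff,
      Set.mem_singleton_iff]
    grind

lemma mapsFaces_expand [NeZero m] :
    MapsFaces.{u} Λ[m + 1, 0] (enlargedHorn m ⊓ zigZagFaces m) (expand m) where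
  monotoneOn _ _ := expand_monotone.monotoneOn _
  face_image_le S hS := by
    rw [face_le_horn_zero_iff] at hS
    obtain ⟨j, hj, hjS⟩ := hS
    simp only [le_inf_iff, face_le_enlargedHorn_iff, face_le_zigZagFaces_iff, Finset.mem_image,
      not_exists, not_and, Fin.ext_iff, expand]
    refine ⟨?_, Or.inl (by grind)⟩
    by_cases hj₁ : j.1 = 1
    · grind
    · exact Or.inl ⟨⟨j.1 + 2, by lia⟩, by simp only; lia, by grind⟩

lemma mapsFaces_contract {A B : (Δ[m + 3] : SSet.{u}).Subcomplex}
    (hB : faceAvoiding {0, 2, 3} ≤ B) : MapsFaces A B (contract m) where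
  monotoneOn _ _ := contract_monotone.monotoneOn _
  face_image_le S _ := by
    refine le_trans ?_ hB
    simp only [face_le_faceAvoiding_iff, Finset.forall_mem_image, contract, Set.mem_insert_iff,
      Set.mem_singleton_iff]
    grind

lemma mapsFaces_castLE [NeZero m] :
    MapsFaces.{u} (⊤ : (Δ[1] : SSet.{u}).Subcomplex) Λ[m + 1, 0]
      (Fin.castLE (by lia : 2 ≤ m + 2)) where
  monotoneOn _ _ := (Fin.strictMono_castLE _).monotone.monotoneOn _
  face_image_le S _ := by
    have := NeZero.pos m
    exact (face_le_horn_zero_iff _).2 ⟨Fin.last _, by simp, by simp [Fin.ext_iff]; grind⟩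

lemma hornEdge01_eq [NeZero m] (hm : 2 ≤ m + 1) :
    hornEdge01.{u} (m + 1) hm = (Subcomplex.topIso _).inv ≫ mapsFaces_castLE.hom := by
  refine yonedaEquiv.injective ?_
  rw [hornEdge01, Equiv.apply_symm_apply]
  refine Subtype.ext ?_
  ext i : 1
  fin_cases i
  · rfl
  · exact Fin.ext (Nat.mod_eq_of_lt (by lia))

end VertexMaps

variable {E S : SSet.{u}}

/-- A witness that the edge `a` is invertible: a `3`-simplex `x → y → x → y` whose
face `0, 2, 3` is a degeneration of `a` and whose edge `1, 3` is degenerate. -/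
structure ZigZag (a : Δ[1] ⟶ E) where
  simplex : Δ[3] ⟶ E
  ι_simplex : (zigZagFaces 0).ι ≫ simplex =
    (mapsFaces_collapse_top (m := 0)).hom ≫ Subcomplex.ι _ ≫ a

/-- The image of a zigzag under a morphism of simplicial sets. -/
def ZigZag.map {a : Δ[1] ⟶ E} (z : ZigZag a) (φ : E ⟶ S) : ZigZag (a ≫ φ) where
  simplex := z.simplex ≫ φ
  ι_simplex := by rw [← Category.assoc, z.ι_simplex, Category.assoc, Category.assoc]

end OuterHorn

section Lifting

variable {E S : SSet.{u}} {m : ℕ}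

/-- The map `0, 1, 2, 3, 4, … ↦ 0, 1, 2, 3, 3, …` on vertices. -/
def truncate (m : ℕ) (i : Fin (m + 4)) : Fin 4 := ⟨min i.1 3, by lia⟩

lemma truncate_monotone : Monotone (truncate m) := fun i j hij ↦ by
  simp only [Fin.le_def, truncate] at hij ⊢
  lia

lemma mapsFaces_truncate {A : (Δ[m + 3] : SSet.{u}).Subcomplex}
    (hA : A ≤ zigZagFaces m ⊓ faceAvoiding (Set.Ici 4)) :
    MapsFaces A (zigZagFaces 0) (truncate m) where
  monotoneOn _ _ := truncate_monotone.monotoneOn _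
  face_image_le S hS := by
    have hS' := hS.trans hA
    rw [le_inf_iff, face_le_zigZagFaces_iff, face_le_faceAvoiding_iff] at hS'
    simp only [face_le_zigZagFaces_iff, Finset.forall_mem_image, truncate]
    grind

lemma faceAvoiding_zero_two_three_le :
    faceAvoiding.{u} {0, 2, 3} ≤ tailHorn m ⊔ faceAvoiding {3} :=
  le_sup_of_le_right (faceAvoiding_anti (by simp))

lemma mapsFaces_contract_zigZagFaces {A : (Δ[m + 3] : SSet.{u}).Subcomplex} :
    MapsFaces A (zigZagFaces m) (contract m) :=
  mapsFaces_contract (le_sup_of_le_right (faceAvoiding_anti (by grind)))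

lemma collapse_contract {i : Fin (m + 4)} (h : i.1 ∉ ({0, 2} : Set ℕ)) :
    collapse m (contract m i) = collapse m i := by
  simp only [Set.mem_insert_iff, Set.mem_singleton_iff] at h
  simp only [collapse, contract, Fin.ext_iff]
  grind

lemma contract_comp_eq_homOfLE_comp {g : (Δ[m + 1] : SSet.{u}) ⟶ S}
    {q : ((⊤ : (Δ[m + 3] : SSet.{u}).Subcomplex) : SSet.{u}) ⟶ S}
    (hqg : Subcomplex.homOfLE le_top ≫ q = mapsFaces_collapse_top.hom ≫ Subcomplex.ι _ ≫ g) :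
    (mapsFaces_contract_zigZagFaces (A := faceAvoiding {0, 2})).hom ≫
      Subcomplex.homOfLE le_top ≫ q = Subcomplex.homOfLE le_top ≫ q := by
  have hle : faceAvoiding.{u} {0, 2} ≤ zigZagFaces m := le_sup_right
  have hcollapse : (mapsFaces_contract_zigZagFaces (m := m) (A := faceAvoiding {0, 2})).hom ≫
      mapsFaces_collapse_top.hom = (mapsFaces_collapse_top.of_le hle).hom :=
    MapsFaces.hom_eq_hom ((mapsFaces_contract_zigZagFaces (m := m)).comp mapsFaces_collapse_top) _
      fun S hS i hi ↦ collapse_contract ((face_le_faceAvoiding_iff S _).1 hS i hi)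
  calc
    _ = (mapsFaces_collapse_top.of_le hle).hom ≫ Subcomplex.ι _ ≫ g := by
      rw [hqg, ← hcollapse]; rfl
    _ = Subcomplex.homOfLE hle ≫ Subcomplex.homOfLE le_top ≫ q := by rw [hqg]; rfl

variable [NeZero m]

lemma exists_extension_enlargedHorn [Quasicategory E] {hm : 2 ≤ m + 1}
    (f : (Λ[m + 1, 0] : SSet.{u}) ⟶ E) (z : ZigZag (hornEdge01 (m + 1) hm ≫ f)) :
    ∃ k : (enlargedHorn m : SSet.{u}) ⟶ E,
      Subcomplex.homOfLE inf_le_left ≫ k = (mapsFaces_collapse le_rfl).hom ≫ f := by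
  have htruncate := mapsFaces_truncate (m := m) (inf_le_inf_right (faceAvoiding.{u} (Set.Ici 4))
    (inf_le_right : enlargedHorn m ⊓ zigZagFaces m ≤ zigZagFaces m))
  have hcollapse : Subcomplex.homOfLE inf_le_left ≫ (mapsFaces_collapse le_rfl).hom =
      htruncate.hom ≫ mapsFaces_collapse_top.hom ≫ mapsFaces_castLE.hom := by
    refine MapsFaces.hom_eq_hom ((mapsFaces_collapse le_rfl).of_le inf_le_left)
      (htruncate.comp (mapsFaces_collapse_top.comp mapsFaces_castLE)) fun S hS i hi ↦ ?_
    rw [le_inf_iff, face_le_faceAvoiding_iff] at hS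
    have := hS.2 i hi
    simp only [collapse, truncate, Function.comp, Fin.ext_iff, Fin.val_castLE, Set.mem_Ici]
      at this ⊢
    grind
  have hsimplex : (zigZagFaces 0).ι ≫ z.simplex =
      mapsFaces_collapse_top.hom ≫ mapsFaces_castLE.hom ≫ f :=
    z.ι_simplex.trans (by rw [hornEdge01_eq]; rfl)
  obtain ⟨k, hk, -⟩ := exists_extension_of_sup_le enlargedHorn_inf_zigZagFaces_sup_le
    innerAnodyneExtensions_enlargedHorn_inf_zigZagFaces_sup ((mapsFaces_collapse le_rfl).hom ≫ f)
    ((MapsFaces.top_of_monotone truncate_monotone).hom ≫ Subcomplex.ι _ ≫ z.simplex) (by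
      calc
        _ = (Subcomplex.homOfLE inf_le_left ≫ (mapsFaces_collapse le_rfl).hom) ≫ f := rfl
        _ = htruncate.hom ≫ (zigZagFaces 0).ι ≫ z.simplex := by rw [hcollapse, hsimplex]; rfl
        _ = _ := rfl)
  exact ⟨k, hk⟩

lemma mapsFaces_contract_inf {A : (Δ[m + 3] : SSet.{u}).Subcomplex} (hA : A ≤ tailHorn m) :
    MapsFaces A (enlargedHorn m ⊓ zigZagFaces m) (contract m) where
  monotoneOn _ _ := contract_monotone.monotoneOn _
  face_image_le S hS := by
    refine le_inf ?_ (mapsFaces_contract_zigZagFaces.face_image_le S hS)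
    obtain ⟨j, hj, hjS⟩ := (face_le_tailHorn_iff S).1 (hS.trans hA)
    refine (face_le_enlargedHorn_iff _).2 (Or.inl ⟨j, hj, ?_⟩)
    simp only [Finset.mem_image, Fin.ext_iff, contract, not_exists]
    grind

lemma homOfLE_comp_eq_contract_comp (f : (Λ[m + 1, 0] : SSet.{u}) ⟶ E)
    (k : ((tailHorn m ⊔ faceAvoiding {3} : (Δ[m + 3] : SSet.{u}).Subcomplex) : SSet.{u}) ⟶ E)
    (hk : Subcomplex.homOfLE (inf_le_left.trans enlargedHorn_le) ≫ k =
      (mapsFaces_collapse le_rfl).hom ≫ f) :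
    Subcomplex.homOfLE
        (inf_le_left : (tailHorn m ⊔ faceAvoiding {3}) ⊓ faceAvoiding {0, 2} ≤ _) ≫ k =
      Subcomplex.homOfLE inf_le_right ≫
        (mapsFaces_contract faceAvoiding_zero_two_three_le).hom ≫ k := by
  refine hom_ext_of_le_sup inf_le_left ?_ ?_
  · have hle : (tailHorn m ⊔ faceAvoiding {3}) ⊓ faceAvoiding.{u} {0, 2} ⊓ tailHorn m ≤
        enlargedHorn m ⊓ zigZagFaces m :=
      le_inf (inf_le_right.trans le_sup_left)
        (inf_le_left.trans (inf_le_right.trans le_sup_right))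
    have hcontract := mapsFaces_contract_inf (m := m) (inf_le_right :
      (tailHorn m ⊔ faceAvoiding {3}) ⊓ faceAvoiding.{u} {0, 2} ⊓ tailHorn m ≤ tailHorn m)
    have hcollapse : (mapsFaces_collapse hle).hom =
        hcontract.hom ≫ (mapsFaces_collapse le_rfl).hom := by
      refine MapsFaces.hom_eq_hom _ (hcontract.comp (mapsFaces_collapse le_rfl))
        fun S hS i hi ↦ (collapse_contract ?_).symm
      exact (face_le_faceAvoiding_iff S _).1 (hS.trans (inf_le_left.trans inf_le_right)) i hi
    calc
      _ = Subcomplex.homOfLE hle ≫ (mapsFaces_collapse le_rfl).hom ≫ f := by rw [← hk]; rfl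
      _ = (mapsFaces_collapse hle).hom ≫ f := rfl
      _ = hcontract.hom ≫ (mapsFaces_collapse le_rfl).hom ≫ f := by rw [hcollapse]; rfl
      _ = _ := by rw [← hk]; rfl
  · have hcontract : (mapsFaces_contract faceAvoiding_zero_two_three_le).hom =
        Subcomplex.homOfLE (inf_le_left.trans inf_le_left :
          (tailHorn m ⊔ faceAvoiding {3}) ⊓ faceAvoiding.{u} {0, 2} ⊓ faceAvoiding {3} ≤ _) := by
      refine MapsFaces.hom_eq_homOfLE _ _ fun S hS i hi ↦ ?_
      simp only [le_inf_iff, face_le_faceAvoiding_iff] at hS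
      have h₀₂ := hS.1.2 i hi
      have h₃ := hS.2 i hi
      simp only [contract, Fin.ext_iff]
      grind
    exact congr($hcontract.symm ≫ k)

variable (p : E ⟶ S)

lemma exists_extension_base [Quasicategory S] {f : (Λ[m + 1, 0] : SSet.{u}) ⟶ E}
    {g : (Δ[m + 1] : SSet.{u}) ⟶ S} (w : f ≫ p = Λ[m + 1, 0].ι ≫ g)
    {k : (enlargedHorn m : SSet.{u}) ⟶ E}
    (hk : Subcomplex.homOfLE inf_le_left ≫ k = (mapsFaces_collapse le_rfl).hom ≫ f) :
    ∃ q : ((⊤ : (Δ[m + 3] : SSet.{u}).Subcomplex) : SSet.{u}) ⟶ S,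
      Subcomplex.homOfLE le_top ≫ q = k ≫ p ∧
      Subcomplex.homOfLE le_top ≫ q = mapsFaces_collapse_top.hom ≫ Subcomplex.ι _ ≫ g := by
  refine exists_extension_of_sup_le le_top innerAnodyneExtensions_enlargedHorn_sup_zigZagFaces
    (k ≫ p) (mapsFaces_collapse_top.hom ≫ Subcomplex.ι _ ≫ g) ?_
  calc
    _ = (mapsFaces_collapse le_rfl).hom ≫ f ≫ p := by
      rw [← Category.assoc, hk, Category.assoc]
    _ = _ := by rw [w]; rfl

lemma exists_lift_enlargedHorn [InnerFibration p] {f : (Λ[m + 1, 0] : SSet.{u}) ⟶ E}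
    {g : (Δ[m + 1] : SSet.{u}) ⟶ S} {k : (enlargedHorn m : SSet.{u}) ⟶ E}
    (hk : Subcomplex.homOfLE inf_le_left ≫ k = (mapsFaces_collapse le_rfl).hom ≫ f)
    {q : ((⊤ : (Δ[m + 3] : SSet.{u}).Subcomplex) : SSet.{u}) ⟶ S}
    (hqk : Subcomplex.homOfLE le_top ≫ q = k ≫ p)
    (hqg : Subcomplex.homOfLE le_top ≫ q = mapsFaces_collapse_top.hom ≫ Subcomplex.ι _ ≫ g) :
    ∃ l : ((tailHorn m ⊔ faceAvoiding {3} ⊔ faceAvoiding {2} :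
        (Δ[m + 3] : SSet.{u}).Subcomplex) : SSet.{u}) ⟶ E,
      Subcomplex.homOfLE (inf_le_left.trans (enlargedHorn_le.trans le_sup_left)) ≫ l =
        (mapsFaces_collapse le_rfl).hom ≫ f ∧ l ≫ p = Subcomplex.homOfLE le_top ≫ q := by
  have hlift := innerAnodyneExtensions_enlargedHorn_le (m := m) p (mem_innerFibrations p)
  have sq : CommSq k (Subcomplex.homOfLE enlargedHorn_le) p (Subcomplex.homOfLE le_top ≫ q) :=
    ⟨hqk.symm⟩
  have hkl : Subcomplex.homOfLE (inf_le_left.trans enlargedHorn_le) ≫ sq.lift =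
      (mapsFaces_collapse le_rfl).hom ≫ f :=
    congr(Subcomplex.homOfLE _ ≫ $sq.fac_left).trans hk
  obtain ⟨l, hl, -, hlp⟩ := exists_lift_of_sup_le sup_faceAvoiding_zero_two_le
    innerAnodyneExtensions_sup_faceAvoiding_zero_two p sq.lift
    ((mapsFaces_contract faceAvoiding_zero_two_three_le).hom ≫ sq.lift)
    (homOfLE_comp_eq_contract_comp f sq.lift hkl) (Subcomplex.homOfLE le_top ≫ q)
    sq.fac_right (by
      rw [Category.assoc, sq.fac_right]
      exact contract_comp_eq_homOfLE_comp hqg)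
  exact ⟨l, congr(Subcomplex.homOfLE _ ≫ $hl).trans hkl, hlp⟩

lemma exists_lift_of_zigZag [Quasicategory E] [Quasicategory S] [InnerFibration p]
    {hm : 2 ≤ m + 1} (f : (Λ[m + 1, 0] : SSet.{u}) ⟶ E) (g : (Δ[m + 1] : SSet.{u}) ⟶ S)
    (w : f ≫ p = Λ[m + 1, 0].ι ≫ g) (z : ZigZag (hornEdge01 (m + 1) hm ≫ f)) :
    ∃ h : (Δ[m + 1] : SSet.{u}) ⟶ E, Λ[m + 1, 0].ι ≫ h = f ∧ h ≫ p = g := by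
  obtain ⟨k, hk⟩ := exists_extension_enlargedHorn f z
  obtain ⟨q, hqk, hqg⟩ := exists_extension_base p w hk
  obtain ⟨l, hl, hlp⟩ := exists_lift_enlargedHorn p hk hqk hqg
  have hle : faceAvoiding.{u} {1, 2} ≤ tailHorn m ⊔ faceAvoiding {3} ⊔ faceAvoiding {2} :=
    le_sup_of_le_right (faceAvoiding_anti (by simp))
  refine ⟨(Subcomplex.topIso _).inv ≫ (mapsFaces_expand_top hle).hom ≫ l, ?_, ?_⟩
  · have hid : mapsFaces_expand.hom ≫ (mapsFaces_collapse (m := m) le_rfl).hom = 𝟙 _ :=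
      MapsFaces.hom_eq_homOfLE (mapsFaces_expand.comp (mapsFaces_collapse le_rfl)) le_rfl
        fun _ _ i _ ↦ collapse_expand i
    calc
      _ = mapsFaces_expand.hom ≫ (mapsFaces_collapse le_rfl).hom ≫ f := by rw [← hl]; rfl
      _ = f := by rw [← Category.assoc, hid, Category.id_comp]
  · have hexpand := mapsFaces_expand_top (m := m) (B := zigZagFaces.{u} m)
      (le_sup_of_le_left (faceAvoiding_anti (by simp)))
    have hid : hexpand.hom ≫ mapsFaces_collapse_top.hom = 𝟙 _ :=
      MapsFaces.hom_eq_homOfLE (hexpand.comp mapsFaces_collapse_top) le_rfl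
        fun _ _ i _ ↦ collapse_expand i
    calc
      _ = (Subcomplex.topIso _).inv ≫ hexpand.hom ≫ Subcomplex.homOfLE le_top ≫ q := by
        rw [Category.assoc, Category.assoc, hlp]; rfl
      _ = (Subcomplex.topIso _).inv ≫ (hexpand.hom ≫ mapsFaces_collapse_top.hom) ≫
          Subcomplex.ι _ ≫ g := by rw [hqg]; rfl
      _ = g := by rw [hid]; rfl

end Lifting

section HomotopyCategory

section HornFilling

variable {X : SSet.{u}} [Quasicategory X]

lemma exists_simplex₂₁ (f₀ f₂ : X _⦋1⦌) (h : X.δ 0 f₂ = X.δ 1 f₀) :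
    ∃ s : X _⦋2⦌, X.δ 0 s = f₀ ∧ X.δ 2 s = f₂ := by
  obtain ⟨φ, h₂, h₀⟩ := horn₂₁.isPushout.exists_desc (yonedaEquiv.symm f₂) (yonedaEquiv.symm f₀)
    (by simp only [stdSimplex.δ_comp_yonedaEquiv_symm, h])
  obtain ⟨s, rfl⟩ := Quasicategory.hornFilling (by simp) (by simp [Fin.lt_def]) φ
  rw [← Category.assoc, horn.ι_ι] at h₀ h₂
  refine ⟨yonedaEquiv s, ?_, ?_⟩ <;> rw [← stdSimplex.yonedaEquiv_δ_comp] <;> simp [*]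

lemma exists_simplex₃₁ (f₀ f₂ f₃ : X _⦋2⦌) (h₁₂ : X.δ 2 f₀ = X.δ 0 f₃)
    (h₁₃ : X.δ 1 f₀ = X.δ 0 f₂) (h₂₃ : X.δ 2 f₂ = X.δ 2 f₃) :
    ∃ s : X _⦋3⦌, X.δ 0 s = f₀ ∧ X.δ 2 s = f₂ ∧ X.δ 3 s = f₃ := by
  obtain ⟨φ, h₀, h₂, h₃⟩ := horn₃₁.exists_desc (yonedaEquiv.symm f₀) (yonedaEquiv.symm f₂)
    (yonedaEquiv.symm f₃) (by simp only [stdSimplex.δ_comp_yonedaEquiv_symm, h₁₂])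
    (by simp only [stdSimplex.δ_comp_yonedaEquiv_symm, h₁₃])
    (by simp only [stdSimplex.δ_comp_yonedaEquiv_symm, h₂₃])
  obtain ⟨s, rfl⟩ := Quasicategory.hornFilling (by simp) (by simp [Fin.lt_def]) φ
  rw [← Category.assoc, horn.ι_ι] at h₀ h₂ h₃
  refine ⟨yonedaEquiv s, ?_, ?_, ?_⟩ <;> rw [← stdSimplex.yonedaEquiv_δ_comp] <;> simp [*]

lemma exists_simplex₃₂ (f₀ f₁ f₃ : X _⦋2⦌) (h₀₂ : X.δ 2 f₁ = X.δ 1 f₃)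
    (h₁₂ : X.δ 2 f₀ = X.δ 0 f₃) (h₂₃ : X.δ 0 f₀ = X.δ 0 f₁) :
    ∃ s : X _⦋3⦌, X.δ 0 s = f₀ ∧ X.δ 1 s = f₁ ∧ X.δ 3 s = f₃ := by
  obtain ⟨φ, h₀, h₂, h₃⟩ := horn₃₂.exists_desc (yonedaEquiv.symm f₀) (yonedaEquiv.symm f₁)
    (yonedaEquiv.symm f₃) (by simp only [stdSimplex.δ_comp_yonedaEquiv_symm, h₀₂])
    (by simp only [stdSimplex.δ_comp_yonedaEquiv_symm, h₁₂])
    (by simp only [stdSimplex.δ_comp_yonedaEquiv_symm, h₂₃])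
  obtain ⟨s, rfl⟩ := Quasicategory.hornFilling (by simp) (by simp [Fin.lt_def]) φ
  rw [← Category.assoc, horn.ι_ι] at h₀ h₂ h₃
  refine ⟨yonedaEquiv s, ?_, ?_, ?_⟩ <;> rw [← stdSimplex.yonedaEquiv_δ_comp] <;> simp [*]

instance : Truncated.Quasicategory₂ ((truncation 2).obj X) where
  fill21 e₀₁ e₁₂ := by
    obtain ⟨s, h₀, h₂⟩ := exists_simplex₂₁ (X := X) e₁₂.edge e₀₁.edge
      (e₀₁.tgt_eq.trans e₁₂.src_eq.symm)
    refine ⟨⟨⟨X.δ 1 s, ?_, ?_⟩, ⟨s, h₂, h₀, rfl⟩⟩⟩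
    · exact (δ_comp_δ_self_apply (i := 1) s).trans ((congrArg (X.δ 1) h₂).trans e₀₁.src_eq)
    · exact (δ_comp_δ_self_apply (i := 0) s).symm.trans ((congrArg (X.δ 0) h₀).trans e₁₂.tgt_eq)
  fill31 f₃ f₀ f₂ := by
    obtain ⟨s, h₀, h₂, h₃⟩ := exists_simplex₃₁ (X := X)
      f₀.simplex f₂.simplex f₃.simplex (f₀.d₂.trans f₃.d₀.symm) (f₀.d₁.trans f₂.d₀.symm)
      (f₂.d₂.trans f₃.d₂.symm)
    refine ⟨⟨X.δ 1 s, ?_, ?_, ?_⟩⟩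
    · exact (δ_comp_δ_apply (i := 1) (j := 2) (by decide) s).symm.trans
        ((congrArg (X.δ 1) h₃).trans f₃.d₁)
    · exact (δ_comp_δ_self_apply (i := 0) s).symm.trans ((congrArg (X.δ 0) h₀).trans f₀.d₀)
    · exact (δ_comp_δ_self_apply (i := 1) s).trans ((congrArg (X.δ 1) h₂).trans f₂.d₁)
  fill32 f₃ f₀ f₁ := by
    obtain ⟨s, h₀, h₁, h₃⟩ := exists_simplex₃₂ (X := X)
      f₀.simplex f₁.simplex f₃.simplex (f₁.d₂.trans f₃.d₁.symm) (f₀.d₂.trans f₃.d₀.symm)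
      (f₀.d₀.trans f₁.d₀.symm)
    refine ⟨⟨X.δ 2 s, ?_, ?_, ?_⟩⟩
    · exact (δ_comp_δ_self_apply (i := 2) s).trans ((congrArg (X.δ 2) h₃).trans f₃.d₂)
    · exact (δ_comp_δ_apply (i := 0) (j := 1) (by decide) s).trans
        ((congrArg (X.δ 1) h₀).trans f₀.d₁)
    · exact (δ_comp_δ_self_apply (i := 1) s).symm.trans ((congrArg (X.δ 1) h₁).trans f₁.d₁)

end HornFilling

section Truncated

open SSet.Truncated SimplicialObject.Truncated

variable {A : Truncated.{u} 2} [Quasicategory₂ A] {x y : A _⦋0⦌₂}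

variable (A) in
/-- The comparison functor from the homotopy category of a `2`-truncated quasicategory
to the category of homotopy classes of edges. -/
noncomputable def toHomotopyCategory₂ : A.HomotopyCategory ⥤ HomotopyCategory₂ A :=
  HomotopyCategory.lift HomotopyCategory₂.mk HomotopyCategory₂.homMk
    (fun x ↦ HomotopyCategory₂.homMk_id ⟨x⟩) (fun s ↦ s.homotopyCategory₂_fac)

lemma exists_inverse_of_isIso (e : Edge x y) (he : IsIso (HomotopyCategory.homMk e)) :
    ∃ e' : Edge y x, Nonempty (Edge.CompStruct e e' (.id x)) ∧
      Nonempty (Edge.CompStruct e' e (.id y)) := by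
  have h : (toHomotopyCategory₂ A).map (HomotopyCategory.homMk e) = HomotopyCategory₂.homMk e :=
    HomotopyCategory.lift_map_homMk _ _ _ _ _
  have : IsIso (HomotopyCategory₂.homMk e) := by
    rw [← h]
    exact Functor.map_isIso (toHomotopyCategory₂ A) (HomotopyCategory.homMk e)
  obtain ⟨e', he'⟩ := HomotopyCategory₂.homMk_surjective (inv (HomotopyCategory₂.homMk e))
  refine ⟨e', Edge.CompStruct.nonempty_iff.2 ?_, Edge.CompStruct.nonempty_iff.2 ?_⟩
  · rw [he', IsIso.hom_inv_id]; rfl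
  · rw [he', IsIso.inv_hom_id]; rfl

end Truncated

lemma IsEquivalence.exists_inverse {C : SSet.{u}} [Quasicategory C] {x y : C _⦋0⦌}
    {α : Edge x y} (hα : IsEquivalence α) :
    ∃ β : Edge y x, Nonempty (Edge.CompStruct α β (.id x)) ∧
      Nonempty (Edge.CompStruct β α (.id y)) :=
  exists_inverse_of_isIso α.toTruncated hα

end HomotopyCategory

section ZigZag

variable {C : SSet.{u}} [Quasicategory C] {x y : C _⦋0⦌} {α : Edge x y} {β : Edge y x}

lemma exists_map_of_compStruct (s₃ : Edge.CompStruct α β (.id x))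
    (s₀ : Edge.CompStruct β α (.id y)) :
    ∃ s : Δ[3] ⟶ C,
      SSet.stdSimplex.δ 1 ≫ s = SSet.stdSimplex.σ 0 ≫ yonedaEquiv.symm α.edge ∧
      SSet.stdSimplex.δ 1 ≫ SSet.stdSimplex.δ 0 ≫ s =
        SSet.stdSimplex.σ 0 ≫ SSet.stdSimplex.δ 0 ≫ yonedaEquiv.symm α.edge := by
  obtain ⟨s, h₀, h₁, -⟩ := exists_simplex₃₂ s₀.simplex (C.σ 0 α.edge) s₃.simplex
    ((Edge.CompStruct.idComp α).d₂.trans s₃.d₁.symm) (s₀.d₂.trans s₃.d₀.symm)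
    (s₀.d₀.trans (Edge.CompStruct.idComp α).d₀.symm)
  refine ⟨yonedaEquiv.symm s, ?_, ?_⟩
  · rw [SSet.stdSimplex.δ_comp_yonedaEquiv_symm, SSet.stdSimplex.σ_comp_yonedaEquiv_symm, h₁]
  · simp only [SSet.stdSimplex.δ_comp_yonedaEquiv_symm, SSet.stdSimplex.σ_comp_yonedaEquiv_symm,
      h₀, s₀.d₁, Edge.id_edge, Edge.tgt_eq]

lemma nonempty_zigZag (s₃ : Edge.CompStruct α β (.id x)) (s₀ : Edge.CompStruct β α (.id y)) :
    Nonempty (ZigZag (yonedaEquiv.symm α.edge)) := by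
  obtain ⟨s, hface, hedge⟩ := exists_map_of_compStruct s₃ s₀
  have hι₁ : (zigZagFaces 0 ⊓ faceAvoiding {1}).ι ≫ s =
      (mapsFaces_collapse_top.of_le inf_le_left).hom ≫
        Subcomplex.ι _ ≫ yonedaEquiv.symm α.edge := by
    refine MapsFaces.ι_comp_eq_hom_comp
      (MapsFaces.top_of_monotone (κ := ![0, 0, 1, 2]) (by decide)) _
      (SimplexCategory.δ 1) (SimplexCategory.σ 0) (fun S hS i hi ↦ ?_) (fun S hS i hi ↦ ?_) hface
    all_goals
      have hi₁ := (face_le_faceAvoiding_iff S _).1 (hS.trans inf_le_right) i hi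
      clear hi hS
      revert i
      decide
  have hι₀₂ : (zigZagFaces 0 ⊓ faceAvoiding {0, 2}).ι ≫ s =
      (mapsFaces_collapse_top.of_le inf_le_left).hom ≫
        Subcomplex.ι _ ≫ yonedaEquiv.symm α.edge := by
    refine MapsFaces.ι_comp_eq_hom_comp
      (MapsFaces.top_of_monotone (κ := ![0, 0, 1, 1]) (by decide)) _
      (SimplexCategory.δ 1 ≫ SimplexCategory.δ 0) (SimplexCategory.σ 0 ≫ SimplexCategory.δ 0)
      (fun S hS i hi ↦ ?_) (fun S hS i hi ↦ ?_) hedge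
    all_goals
      have hi₀₂ := (face_le_faceAvoiding_iff S _).1 (hS.trans inf_le_right) i hi
      clear hi hS
      revert i
      decide
  exact ⟨⟨s, hom_ext_of_le_sup le_rfl hι₁ hι₀₂⟩⟩

end ZigZag

section ExtensionFiber

open scoped modelCategoryQuillen in
lemma kanComplex_of_exists_extension {X : SSet.{u}}
    (hX : ∀ (m : ℕ) (β : (∂Δ[m] : SSet.{u}) ⟶ X), ∃ γ : (Δ[m] : SSet.{u}) ⟶ X, ∂Δ[m].ι ≫ γ = β) :
    KanComplex X := by
  have h : modelCategoryQuillen.I.rlp (terminal.from X) := by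
    rintro _ _ _ ⟨m⟩
    refine ⟨fun {β _} _ ↦ ?_⟩
    obtain ⟨γ, hγ⟩ := hX m β
    exact ⟨⟨γ, hγ, Subsingleton.elim _ _⟩⟩
  rw [← rlp_monomorphisms] at h
  rw [KanComplex, HomotopicalAlgebra.isFibrant_iff, modelCategoryQuillen.fibration_iff]
  exact MorphismProperty.antitone_rlp modelCategoryQuillen.J_le_monomorphisms _ h

/-- The map `C ⟶ C ^ L` which sends a simplex to the corresponding constant map. -/
noncomputable def constMap (L C : SSet.{u}) : C ⟶ (ihom L).obj C := MonoidalClosed.curry (snd L C)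

lemma constMap_pre {K L : SSet.{u}} (j : K ⟶ L) (C : SSet.{u}) :
    constMap L C ≫ (MonoidalClosed.pre j).app C = constMap K C := by
  rw [constMap, MonoidalClosed.curry_pre_app, whiskerRight_snd, constMap]

lemma comp_constMap {B C : SSet.{u}} (L : SSet.{u}) (f : B ⟶ C) :
    f ≫ constMap L C = MonoidalClosed.curry (snd L B ≫ f) := by
  rw [constMap, ← MonoidalClosed.curry_natural_left, whiskerLeft_snd]

lemma toUnit_comp_curry' {A C : SSet.{u}} (K : SSet.{u}) (f : A ⟶ C) :
    toUnit K ≫ MonoidalClosed.curry' f = MonoidalClosed.curry (fst A K ≫ f) := by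
  rw [MonoidalClosed.curry', ← MonoidalClosed.curry_natural_left, rightUnitor_hom,
    whiskerLeft_fst_assoc]

lemma exists_extension_extensionFiber {A B C K L : SSet.{u}} (i : A ⟶ B) (f : A ⟶ C) (j : K ⟶ L)
    (H : ∀ g : B ⟶ (ihom K).obj C,
      (f ≫ constMap L C) ≫ (MonoidalClosed.pre j).app C = i ≫ g →
        ∃ h : B ⟶ (ihom L).obj C, i ≫ h = f ≫ constMap L C ∧
          h ≫ (MonoidalClosed.pre j).app C = g)
    (b : K ⟶ extensionFiber i f) :
    ∃ c : L ⟶ extensionFiber i f, j ≫ c = b := by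
  unfold extensionFiber at b ⊢
  obtain ⟨b', hb'⟩ : ∃ b' : B ⊗ K ⟶ C,
      b ≫ pullback.fst _ _ = MonoidalClosed.curry b' :=
    ⟨_, (MonoidalClosed.curry_uncurry _).symm⟩
  have hb : i ▷ K ≫ b' = fst A K ≫ f := by
    apply MonoidalClosed.curry_injective
    rw [← MonoidalClosed.curry_pre_app, ← hb', ← toUnit_comp_curry', Category.assoc,
      pullback.condition, ← Category.assoc]
    congr 1
  obtain ⟨h, h₁, h₂⟩ := H (MonoidalClosed.curry ((β_ K B).hom ≫ b')) (by
    rw [Category.assoc, constMap_pre, comp_constMap, ← MonoidalClosed.curry_natural_left]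
    congr 1
    rw [BraidedCategory.braiding_naturality_right_assoc, hb, braiding_hom_fst_assoc])
  obtain ⟨h, rfl⟩ : ∃ h' : L ⊗ B ⟶ C, MonoidalClosed.curry h' = h :=
    ⟨_, MonoidalClosed.curry_uncurry _⟩
  rw [MonoidalClosed.curry_pre_app] at h₂
  rw [comp_constMap, ← MonoidalClosed.curry_natural_left] at h₁
  have h₁ := MonoidalClosed.curry_injective h₁
  have h₂ := MonoidalClosed.curry_injective h₂
  refine ⟨pullback.lift (MonoidalClosed.curry ((β_ B L).hom ≫ h)) (toUnit L) ?_, ?_⟩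
  · rw [MonoidalClosed.curry_pre_app, toUnit_comp_curry',
      BraidedCategory.braiding_naturality_left_assoc, h₁, braiding_hom_snd_assoc]
  · apply pullback.hom_ext
    · rw [Category.assoc, pullback.lift_fst, hb', ← MonoidalClosed.curry_natural_left,
        BraidedCategory.braiding_naturality_right_assoc, h₂, SymmetricCategory.symmetry_assoc]
    · exact toUnit_unique _ _

end ExtensionFiber

end InftyCat

theorem mainTheorem5 (C : SSet.{u}) [SSet.Quasicategory C] {x y : C _⦋0⦌} (α : SSet.Edge x y)
    (hα : InftyCat.IsEquivalence α) (n : ℕ) (hn : 2 ≤ n) (a : (Λ[n, 0] : SSet.{u}) ⟶ C)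
    (ha : InftyCat.hornEdge01 n hn ≫ a = SSet.yonedaEquiv.symm α.edge) :
    InftyCat.IsContractibleInftyGroupoid (InftyCat.extensionFiber Λ[n, 0].ι a) := by
  have h : ∀ (m : ℕ) (β : (∂Δ[m] : SSet.{u}) ⟶ InftyCat.extensionFiber Λ[n, 0].ι a),
      ∃ γ : (Δ[m] : SSet.{u}) ⟶ _, ∂Δ[m].ι ≫ γ = β := by
    obtain ⟨β, ⟨s₃⟩, ⟨s₀⟩⟩ := hα.exists_inverse
    obtain ⟨z⟩ := InftyCat.nonempty_zigZag s₃ s₀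
    rw [← ha] at z
    obtain ⟨c, rfl⟩ := Nat.exists_eq_add_of_le' hn
    exact fun m ↦ InftyCat.exists_extension_extensionFiber _ _ _
      fun g w ↦ InftyCat.exists_lift_of_zigZag _ _ g w (z.map (InftyCat.constMap Δ[m] C))
  exact ⟨InftyCat.kanComplex_of_exists_extension h, h⟩
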